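/- Let $n>1$ be an integer, let $\phi:\mathbb{R}^n\to\mathbb{R}$ be twice continuously differentiable with $M$-Lipschitz continuous Hessian (with respect to the Euclidean and spectral norms), where $M>0$, and let $f:\mathbb{R}^n\to\mathbb{R}$ be a measurable function with $|f(y)-\phi(y)|\le\epsilon_f$ for all $y\in\mathbb{R}^n$, where $\epsilon_f\ge 0$. Let $x\in\mathbb{R}^n$, $0<\theta<1$, $0<\delta<1$, $\sigma>0$, let $u_1,\dots,u_N$ be independent random vectors with the standard Gaussian distribution $\mathcal{N}(0,I)$ on $\mathbb{R}^n$, and let $$g(x)=\frac{1}{2N}\sum_{i=1}^N\frac{f(x+\sigma u_i)-f(x-\sigma u_i)}{\sigma}\,u_i$$ be the central Gaussian smoothed gradient estimate. Suppose that $$N\ \ge\ \frac{3n}{\delta\theta^2}\,\frac{n}{(\sqrt n-1)^2}+\frac{n+6}{144\,\delta}+\frac{1}{6\delta},$$ $$\sqrt[3]{\frac{\epsilon_f}{\sqrt n\,M}}\ \le\ \sigma\ \le\ \sqrt{\frac{\theta\|\nabla\phi(x)\|}{12\,n^{3/2}M}},\qquad \|\nabla\phi(x)\|\ \ge\ \frac{12\sqrt[3]{n^{7/2}M\epsilon_f^2}}{\theta}.$$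 Then, with probability at least $1-\delta$, the norm condition $$\|g(x)-\nabla\phi(x)\|\le\theta\,\|\nabla\phi(x)\|$$ holds. -/

import Mathlib

open MeasureTheory ProbabilityTheory

noncomputable section

/-- Bounded noise: `f` is a (possibly noisy) evaluation of `φ`, and the noise `f - φ` is
bounded by `εf` in absolute value, uniformly on `ℝⁿ`. -/
def BoundedNoise {n : ℕ} (f φ : EuclideanSpace ℝ (Fin n) → ℝ) (εf : ℝ) : Prop :=
  0 ≤ εf ∧ ∀ y, |f y - φ y| ≤ εf

/-- The Hessian of `φ` at `x`, as the second derivative: the bilinear form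
`(v, w) ↦ vᵀ ∇²φ(x) w`. Its operator norm is the spectral norm of the Hessian matrix. -/
def hessian {n : ℕ} (φ : EuclideanSpace ℝ (Fin n) → ℝ) (x : EuclideanSpace ℝ (Fin n)) :
    EuclideanSpace ℝ (Fin n) →L[ℝ] EuclideanSpace ℝ (Fin n) →L[ℝ] ℝ :=
  fderiv ℝ (fderiv ℝ φ) x

/-- `φ` is twice continuously differentiable and its Hessian is `M`-Lipschitz continuous
on `ℝⁿ`. -/
def HasLipschitzHessian {n : ℕ} (φ : EuclideanSpace ℝ (Fin n) → ℝ) (M : ℝ) : Prop :=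
  ContDiff ℝ 2 φ ∧ ∀ x y, ‖hessian φ x - hessian φ y‖ ≤ M * ‖x - y‖

/-- The central Gaussian smoothed gradient estimate of `f` at `x` with sampling radius `σ` and
sampling directions `u 1, …, u N`:
`g(x) = 1/(2N) ∑ᵢ ((f(x + σ uᵢ) - f(x - σ uᵢ)) / σ) uᵢ`. -/
def centralGSG {n N : ℕ} (f : EuclideanSpace ℝ (Fin n) → ℝ) (σ : ℝ)
    (u : Fin N → EuclideanSpace ℝ (Fin n)) (x : EuclideanSpace ℝ (Fin n)) :
    EuclideanSpace ℝ (Fin n) :=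
  (1 / (2 * (N : ℝ))) • ∑ i, ((f (x + σ • u i) - f (x - σ • u i)) / σ) • u i

/-- The norm condition `‖g - ∇φ(x)‖ ≤ θ ‖∇φ(x)‖` for a gradient estimate `g` at `x`. -/
def NormCondition {n : ℕ} (φ : EuclideanSpace ℝ (Fin n) → ℝ) (θ : ℝ)
    (x g : EuclideanSpace ℝ (Fin n)) : Prop :=
  ‖g - gradient φ x‖ ≤ θ * ‖gradient φ x‖

end

/-!
`g` is the sample mean of `F(u) u`, where the central slope `F(u)` differs from `⟪∇φ(x), u⟫` by at
most `c ‖u‖³ + e`, with `c = Mσ²/6` by Taylor expansion and `e = εf/σ` from the noise. Since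
`E[⟪a, u⟫ u] = a`, the bias of the estimate is `E[ρ(u) u]` with `ρ` the error of the slope; its norm
is at most the `L²` norm of `ρ`, hence at most `θ‖∇φ(x)‖/6` for the given range of `σ`. The
variance of `F(u) u` is at most `25/12 (n + 1) ‖∇φ(x)‖²`, and Chebyshev's inequality for deviations
of `5/6 θ‖∇φ(x)‖` from the mean leaves a failure probability of at most `3 (n + 1) / (N θ²)`,
because `25/12 = 3 (5/6)²`.
-/

open scoped RealInnerProductSpace

section SampleMean

variable {Ω ι E : Type*} [MeasurableSpace Ω] {P : Measure Ω} [Fintype ι]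
  [NormedAddCommGroup E] [InnerProductSpace ℝ E] [CompleteSpace E]

theorem integral_norm_sub_sq_eq_add [IsProbabilityMeasure P] {X : Ω → E} (hX : MemLp X 2 P)
    (a : E) :
    ∫ ω, ‖X ω - a‖ ^ 2 ∂P = ∫ ω, ‖X ω - P[X]‖ ^ 2 ∂P + ‖P[X] - a‖ ^ 2 := by
  have hdev : MemLp (fun ω => X ω - P[X]) 2 P := hX.sub (memLp_const _)
  have hsq : Integrable (fun ω => ‖X ω - P[X]‖ ^ 2) P := hdev.integrable_norm_pow two_ne_zero
  have hcross : Integrable (fun ω => 2 * ⟪P[X] - a, X ω - P[X]⟫) P :=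
    ((hdev.integrable one_le_two).const_inner _).const_mul 2
  have hexpand : ∀ ω, ‖X ω - a‖ ^ 2 =
      ‖X ω - P[X]‖ ^ 2 + 2 * ⟪P[X] - a, X ω - P[X]⟫ + ‖P[X] - a‖ ^ 2 := fun ω => by
    rw [real_inner_comm, ← norm_add_sq_real, sub_add_sub_cancel]
  have hmean : ∫ ω, X ω - P[X] ∂P = 0 := by
    rw [integral_sub (hX.integrable one_le_two) (integrable_const _)]
    simp
  simp_rw [hexpand]
  rw [integral_add (hsq.fun_add hcross) (integrable_const _), integral_add hsq hcross,
    integral_const_mul, integral_inner (hdev.integrable one_le_two), hmean]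
  simp

variable [MeasurableSpace E] [BorelSpace E]

theorem integral_norm_sum_sq_of_pairwise_indepFun [IsFiniteMeasure P] {X : ι → Ω → E}
    (hX : ∀ i, MemLp (X i) 2 P) (hmean : ∀ i, P[X i] = 0)
    (hind : Pairwise fun i j => IndepFun (X i) (X j) P) :
    ∫ ω, ‖∑ i, X i ω‖ ^ 2 ∂P = ∑ i, ∫ ω, ‖X i ω‖ ^ 2 ∂P := by
  have hint : ∀ i j, Integrable (fun ω => ⟪X i ω, X j ω⟫) P := fun i j =>
    memLp_one_iff_integrable.1 ((innerSL ℝ).memLp_of_bilin 1 (hX i) (hX j))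
  have horth : ∀ i j, j ≠ i → ∫ ω, ⟪X i ω, X j ω⟫ ∂P = 0 := fun i j hji => by
    have h : ∫ ω, ⟪X i ω, X j ω⟫ ∂P = ⟪P[X i], P[X j]⟫ := (hind hji.symm).integral_bilin
      ((hX i).integrable one_le_two) ((hX j).integrable one_le_two) (innerSL ℝ)
    rw [h, hmean i, inner_zero_left]
  simp_rw [← real_inner_self_eq_norm_sq, sum_inner, inner_sum]
  rw [integral_finsetSum _ fun i _ => integrable_finsetSum _ fun j _ => hint i j]
  refine Finset.sum_congr rfl fun i _ => ?_
  rw [integral_finsetSum _ fun j _ => hint i j]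
  exact Finset.sum_eq_single_of_mem i (Finset.mem_univ i) fun j _ hji => horth i j hji

theorem measureReal_le_norm_sample_mean_sub_le [IsProbabilityMeasure P] [Nonempty ι]
    {X : ι → Ω → E} (hX : ∀ i, MemLp (X i) 2 P)
    (hind : Pairwise fun i j => IndepFun (X i) (X j) P) {m : E} (hm : ∀ i, P[X i] = m) {V : ℝ}
    (hV : ∀ i, ∫ ω, ‖X i ω - m‖ ^ 2 ∂P ≤ V) {t : ℝ} (ht : 0 < t) :
    P.real {ω | t ≤ ‖(Fintype.card ι : ℝ)⁻¹ • ∑ i, X i ω - m‖} ≤ V / (Fintype.card ι * t ^ 2) := by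
  have hcard : (0 : ℝ) < Fintype.card ι := Nat.cast_pos.2 Fintype.card_pos
  have hdev : ∀ i, MemLp (fun ω => X i ω - m) 2 P := fun i => (hX i).sub (memLp_const m)
  have hdev_mean : ∀ i, ∫ ω, X i ω - m ∂P = 0 := fun i => by
    rw [integral_sub ((hX i).integrable one_le_two) (integrable_const m), hm]
    simp
  have hvar : ∫ ω, ‖∑ i, (X i ω - m)‖ ^ 2 ∂P ≤ Fintype.card ι * V := by
    rw [integral_norm_sum_sq_of_pairwise_indepFun hdev hdev_mean fun i j hij =>
      (hind hij).comp (measurable_sub_const m) (measurable_sub_const m)]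
    simpa using Finset.sum_le_sum fun i (_ : i ∈ Finset.univ) => hV i
  have hset : {ω | t ≤ ‖(Fintype.card ι : ℝ)⁻¹ • ∑ i, X i ω - m‖} =
      {ω | (Fintype.card ι * t) ^ 2 ≤ ‖∑ i, (X i ω - m)‖ ^ 2} := by
    ext ω
    have hmean_sub : (Fintype.card ι : ℝ)⁻¹ • ∑ i, X i ω - m =
        (Fintype.card ι : ℝ)⁻¹ • ∑ i, (X i ω - m) := by
      simp [Finset.sum_sub_distrib, smul_sub, ← Nat.cast_smul_eq_nsmul ℝ, hcard.ne']
    simp only [Set.mem_ofPred_eq]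
    rw [hmean_sub, norm_smul, norm_inv, Real.norm_natCast, le_inv_mul_iff₀ hcard,
      sq_le_sq₀ (by positivity) (norm_nonneg _)]
  have hmarkov := mul_meas_ge_le_integral_of_nonneg (μ := P) (.of_forall fun ω => sq_nonneg _)
    ((memLp_finsetSum Finset.univ fun i _ => hdev i).integrable_norm_pow two_ne_zero)
    ((Fintype.card ι * t) ^ 2)
  rw [hset, le_div_iff₀ (by positivity)]
  refine le_of_mul_le_mul_left ?_ hcard
  calc _ = (Fintype.card ι * t) ^ 2 *
        P.real {ω | (Fintype.card ι * t) ^ 2 ≤ ‖∑ i, (X i ω - m)‖ ^ 2} := by ring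
    _ ≤ _ := hmarkov.trans hvar

end SampleMean

section GaussianMoments

open scoped Nat

theorem integral_pow_two_mul_gaussianReal_zero_one (k : ℕ) :
    ∫ x, x ^ (2 * k) ∂(gaussianReal 0 1) = ((2 * k - 1 : ℕ)‼ : ℝ) := by
  have hdensity : ∀ x : ℝ, gaussianPDFReal 0 1 x • x ^ (2 * k) =
      (√(2 * Real.pi))⁻¹ * (|x| ^ ((2 * k : ℕ) : ℝ) * Real.exp (-(1 / 2) * |x| ^ (2 : ℝ))) := by
    intro x
    rw [Real.rpow_natCast, Real.rpow_two, sq_abs, (even_two_mul k).pow_abs, gaussianPDFReal_def]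
    simp only [smul_eq_mul, NNReal.coe_one, mul_one, sub_zero]
    ring_nf
  have hpi : √Real.pi ≠ 0 := (Real.sqrt_pos.2 Real.pi_pos).ne'
  have hk : (-1 : ℝ) < ((2 * k : ℕ) : ℝ) := neg_one_lt_zero.trans_le (Nat.cast_nonneg _)
  have hexponent : -(((2 * k : ℕ) : ℝ) + 1) / 2 = -(k + 1 / 2) := by push_cast; ring
  have hGamma : (((2 * k : ℕ) : ℝ) + 1) / 2 = k + 1 / 2 := by push_cast; ring
  rw [integral_gaussianReal_eq_integral_smul one_ne_zero, integral_congr_ae (.of_forall hdensity),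
    integral_const_mul, integral_comp_abs (f := fun y : ℝ =>
      y ^ ((2 * k : ℕ) : ℝ) * Real.exp (-(1 / 2) * y ^ (2 : ℝ))),
    integral_rpow_mul_exp_neg_mul_rpow two_pos hk one_half_pos, hexponent, hGamma,
    Real.Gamma_nat_add_half, one_div, Real.inv_rpow two_pos.le, Real.rpow_neg two_pos.le, inv_inv,
    Real.rpow_add two_pos, Real.rpow_natCast, ← one_div, ← one_div, ← Real.sqrt_eq_rpow,
    Real.sqrt_mul two_pos.le]
  field_simp

theorem integral_pow_two_mul_gaussianReal_zero (v : NNReal) (k : ℕ) :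
    ∫ x, x ^ (2 * k) ∂(gaussianReal 0 v) = ((2 * k - 1 : ℕ)‼ : ℝ) * v ^ k := by
  have hscale : gaussianReal 0 v = (gaussianReal 0 1).map (√v * ·) := by
    rw [gaussianReal_map_const_mul, mul_zero, mul_one]
    congr
    ext
    simp
  rw [hscale, integral_map (by fun_prop) (by fun_prop)]
  simp_rw [mul_pow]
  rw [integral_const_mul, integral_pow_two_mul_gaussianReal_zero_one, pow_mul,
    Real.sq_sqrt v.coe_nonneg, mul_comm]

variable {E : Type*} [NormedAddCommGroup E] [InnerProductSpace ℝ E] [FiniteDimensional ℝ E]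
  [MeasurableSpace E] [BorelSpace E]

theorem hasLaw_inner_stdGaussian (a : E) :
    HasLaw (fun u => ⟪a, u⟫) (gaussianReal 0 (‖a‖₊ ^ 2)) (stdGaussian E) where
  aemeasurable := Measurable.aemeasurable (by fun_prop)
  map_eq := by
    have h := IsGaussian.map_eq_gaussianReal (μ := stdGaussian E) (innerSL ℝ a)
    rw [integral_strongDual_stdGaussian, variance_dual_stdGaussian, innerSL_apply_norm] at h
    convert! h using 2
    ext
    simp

theorem memLp_inner_stdGaussian (a : E) {p : ENNReal} (hp : p ≠ ⊤) :
    MemLp (fun u => ⟪a, u⟫) p (stdGaussian E) :=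
  (IsGaussian.memLp_id (stdGaussian E) p hp).const_inner a

theorem integrable_inner_pow_stdGaussian (a : E) (k : ℕ) :
    Integrable (fun u => ⟪a, u⟫ ^ k) (stdGaussian E) := by
  have hnorm := (memLp_inner_stdGaussian a (ENNReal.natCast_ne_top k)).integrable_norm_pow'
  simp_rw [← norm_pow] at hnorm
  exact (integrable_norm_iff (Measurable.aestronglyMeasurable (by fun_prop))).1 hnorm

theorem integrable_norm_pow_stdGaussian (k : ℕ) :
    Integrable (fun u : E => ‖u‖ ^ k) (stdGaussian E) :=
  (IsGaussian.memLp_id (stdGaussian E) k (by simp)).integrable_norm_pow'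

theorem integral_inner_pow_two_mul_stdGaussian (a : E) (k : ℕ) :
    ∫ u, ⟪a, u⟫ ^ (2 * k) ∂(stdGaussian E) = ((2 * k - 1 : ℕ)‼ : ℝ) * ‖a‖ ^ (2 * k) := by
  have h := (hasLaw_inner_stdGaussian a).integral_comp (f := fun x : ℝ => x ^ (2 * k))
    (by fun_prop)
  simpa [integral_pow_two_mul_gaussianReal_zero, ← pow_mul] using h

theorem integral_inner_sq_stdGaussian (a : E) : ∫ u, ⟪a, u⟫ ^ 2 ∂(stdGaussian E) = ‖a‖ ^ 2 := by
  simpa using integral_inner_pow_two_mul_stdGaussian a 1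

theorem integral_inner_mul_inner_stdGaussian (a b : E) :
    ∫ u, ⟪a, u⟫ * ⟪b, u⟫ ∂(stdGaussian E) = ⟪a, b⟫ := by
  have h := covarianceBilin_apply (IsGaussian.memLp_two_id (μ := stdGaussian E)) a b
  simp only [id_eq, integral_id_stdGaussian, sub_zero, covarianceBilin_stdGaussian] at h
  exact h.symm

theorem memLp_two_smul_self_stdGaussian {F : E → ℝ} (hF : MemLp F 4 (stdGaussian E)) :
    MemLp (fun u => F u • u) 2 (stdGaussian E) :=
  have : ENNReal.HolderTriple 4 4 2 := ⟨by
    rw [← ENNReal.toReal_eq_toReal_iff' (by simp) (by simp),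
      ENNReal.toReal_add (by simp) (by simp)]
    norm_num⟩
  (IsGaussian.memLp_id (stdGaussian E) 4 (by simp)).smul hF

theorem memLp_two_inner_smul_self_stdGaussian (a : E) :
    MemLp (fun u => ⟪a, u⟫ • u) 2 (stdGaussian E) :=
  memLp_two_smul_self_stdGaussian (memLp_inner_stdGaussian a (by simp))

theorem integrable_inner_sq_mul_inner_sq_stdGaussian (a b : E) :
    Integrable (fun u => ⟪a, u⟫ ^ 2 * ⟪b, u⟫ ^ 2) (stdGaussian E) := by
  simpa [inner_smul_right, mul_pow] using
    ((memLp_two_inner_smul_self_stdGaussian a).const_inner b).integrable_sq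

theorem integral_inner_sq_mul_inner_sq_stdGaussian (a b : E) :
    ∫ u, ⟪a, u⟫ ^ 2 * ⟪b, u⟫ ^ 2 ∂(stdGaussian E) = ‖a‖ ^ 2 * ‖b‖ ^ 2 + 2 * ⟪a, b⟫ ^ 2 := by
  have hpolar : ∀ u : E, ⟪a, u⟫ ^ 2 * ⟪b, u⟫ ^ 2 =
      (1 / 12) * (⟪a + b, u⟫ ^ 4 + ⟪a - b, u⟫ ^ 4 - 2 * (⟪a, u⟫ ^ 4 + ⟪b, u⟫ ^ 4)) := by
    intro u
    rw [inner_add_left, inner_sub_left]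
    ring
  have hint := fun c : E => integrable_inner_pow_stdGaussian c 4
  have hfourth : ∀ c : E, ∫ u, ⟪c, u⟫ ^ 4 ∂(stdGaussian E) = 3 * (‖c‖ ^ 2) ^ 2 := fun c => by
    rw [← pow_mul]
    exact_mod_cast integral_inner_pow_two_mul_stdGaussian c 2
  simp_rw [hpolar]
  rw [integral_const_mul, integral_sub ((hint _).fun_add (hint _))
    (((hint _).fun_add (hint _)).const_mul 2), integral_const_mul, integral_add (hint _) (hint _),
    integral_add (hint _) (hint _), hfourth, hfourth, hfourth, hfourth, norm_add_sq_real,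
    norm_sub_sq_real]
  ring

theorem integral_inner_sq_mul_norm_sq_stdGaussian (a : E) :
    ∫ u, ⟪a, u⟫ ^ 2 * ‖u‖ ^ 2 ∂(stdGaussian E) = (Module.finrank ℝ E + 2) * ‖a‖ ^ 2 := by
  let b := stdOrthonormalBasis ℝ E
  simp_rw [← b.sum_sq_inner_right, Finset.mul_sum]
  rw [integral_finsetSum _ fun i _ => integrable_inner_sq_mul_inner_sq_stdGaussian a (b i)]
  simp_rw [integral_inner_sq_mul_inner_sq_stdGaussian, Finset.sum_add_distrib, ← Finset.mul_sum,
    b.sum_sq_inner_left, b.sum_sq_inner_right, b.norm_eq_one]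
  simp only [one_pow, mul_one, Finset.sum_const, Finset.card_univ, Fintype.card_fin, nsmul_eq_mul]
  ring

theorem integral_norm_pow_two_mul_stdGaussian_le (k : ℕ) :
    ∫ u, ‖u‖ ^ (2 * k) ∂(stdGaussian E) ≤
      ((2 * k - 1 : ℕ)‼ : ℝ) * (Module.finrank ℝ E : ℝ) ^ k := by
  rcases k with _ | k
  · simp
  let b := stdOrthonormalBasis ℝ E
  have hpow_mean : ∀ u : E, ‖u‖ ^ (2 * (k + 1)) ≤
      (Module.finrank ℝ E : ℝ) ^ k * ∑ i, ⟪b i, u⟫ ^ (2 * (k + 1)) := fun u => by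
    simp_rw [pow_mul]
    rw [← b.sum_sq_inner_right]
    simpa using pow_sum_le_card_mul_sum_pow (s := Finset.univ) (f := fun i => ⟪b i, u⟫ ^ 2)
      (fun _ _ => sq_nonneg _) k
  have hint : ∀ i, Integrable (fun u => ⟪b i, u⟫ ^ (2 * (k + 1))) (stdGaussian E) :=
    fun i => integrable_inner_pow_stdGaussian (b i) _
  calc ∫ u, ‖u‖ ^ (2 * (k + 1)) ∂(stdGaussian E)
      ≤ ∫ u, (Module.finrank ℝ E : ℝ) ^ k * ∑ i, ⟪b i, u⟫ ^ (2 * (k + 1)) ∂(stdGaussian E) :=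
        integral_mono (integrable_norm_pow_stdGaussian _)
          ((integrable_finsetSum _ fun i _ => hint i).const_mul _) hpow_mean
    _ = (Module.finrank ℝ E : ℝ) ^ k *
          ∑ _i : Fin (Module.finrank ℝ E), ((2 * (k + 1) - 1 : ℕ)‼ : ℝ) := by
        rw [integral_const_mul, integral_finsetSum _ fun i _ => hint i]
        simp_rw [integral_inner_pow_two_mul_stdGaussian, b.norm_eq_one, one_pow, mul_one]
    _ = _ := by
        simp only [Finset.sum_const, Finset.card_univ, Fintype.card_fin, nsmul_eq_mul]
        ring

end GaussianMoments

section GaussianEstimator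

open scoped Nat

variable {E : Type*} [NormedAddCommGroup E] [InnerProductSpace ℝ E] [FiniteDimensional ℝ E]
  [MeasurableSpace E] [BorelSpace E]

theorem integral_inner_smul_self_stdGaussian (a : E) :
    ∫ u, ⟪a, u⟫ • u ∂(stdGaussian E) = a := by
  refine ext_inner_left ℝ fun v => ?_
  rw [← integral_inner ((memLp_two_inner_smul_self_stdGaussian a).integrable one_le_two)]
  simp_rw [inner_smul_right]
  rw [integral_inner_mul_inner_stdGaussian, real_inner_comm]

theorem integral_norm_inner_smul_self_sub_sq_stdGaussian (a : E) :
    ∫ u, ‖⟪a, u⟫ • u - a‖ ^ 2 ∂(stdGaussian E) = (Module.finrank ℝ E + 1) * ‖a‖ ^ 2 := by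
  have hdecomp := integral_norm_sub_sq_eq_add (memLp_two_inner_smul_self_stdGaussian a) 0
  simp only [sub_zero, integral_inner_smul_self_stdGaussian, norm_smul, mul_pow,
    Real.norm_eq_abs, sq_abs, integral_inner_sq_mul_norm_sq_stdGaussian] at hdecomp
  linarith

theorem integrable_smul_self_stdGaussian {ρ : E → ℝ} (hρ : MemLp ρ 2 (stdGaussian E)) :
    Integrable (fun u => ρ u • u) (stdGaussian E) :=
  memLp_one_iff_integrable.1 (IsGaussian.memLp_two_id.smul hρ)

-- Pair the left-hand side with itself and apply `2xy ≤ x² + y²`, as `∫ ⟪v, u⟫² = ‖v‖²`.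
theorem norm_integral_smul_self_sq_le_integral_sq {ρ : E → ℝ} (hρ : MemLp ρ 2 (stdGaussian E)) :
    ‖∫ u, ρ u • u ∂(stdGaussian E)‖ ^ 2 ≤ ∫ u, ρ u ^ 2 ∂(stdGaussian E) := by
  set v := ∫ u, ρ u • u ∂(stdGaussian E) with hv
  have hinner_sq := integrable_inner_pow_stdGaussian v 2
  have hself : ‖v‖ ^ 2 = ∫ u, ρ u * ⟪v, u⟫ ∂(stdGaussian E) := by
    simp_rw [← inner_smul_right]
    rw [integral_inner (integrable_smul_self_stdGaussian hρ), ← hv, real_inner_self_eq_norm_sq]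
  have hyoung : ∫ u, ρ u * ⟪v, u⟫ ∂(stdGaussian E) ≤
      ∫ u, (ρ u ^ 2 + ⟪v, u⟫ ^ 2) / 2 ∂(stdGaussian E) :=
    integral_mono (hρ.integrable_mul (memLp_inner_stdGaussian v (p := 2) (by simp)))
      ((hρ.integrable_sq.add hinner_sq).div_const 2) fun u => by
        simp only
        linarith [two_mul_le_add_sq (ρ u) ⟪v, u⟫]
  rw [integral_div, integral_add hρ.integrable_sq hinner_sq, integral_inner_sq_stdGaussian]
    at hyoung
  linarith

theorem norm_integral_smul_self_sub_sq_le {F : E → ℝ} (hF : MemLp F 2 (stdGaussian E)) (a : E) :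
    ‖∫ u, F u • u ∂(stdGaussian E) - a‖ ^ 2 ≤ ∫ u, (F u - ⟪a, u⟫) ^ 2 ∂(stdGaussian E) := by
  have ha : MemLp (fun u => ⟪a, u⟫) 2 (stdGaussian E) := memLp_inner_stdGaussian a (by simp)
  have hbias : ∫ u, F u • u ∂(stdGaussian E) - a =
      ∫ u, (F u - ⟪a, u⟫) • u ∂(stdGaussian E) := by
    simp_rw [sub_smul]
    rw [integral_sub (integrable_smul_self_stdGaussian hF) (integrable_smul_self_stdGaussian ha),
      integral_inner_smul_self_stdGaussian]
  rw [hbias]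
  exact norm_integral_smul_self_sq_le_integral_sq (hF.sub ha)

theorem integral_norm_smul_self_sub_sq_le {F : E → ℝ} (hF : MemLp F 4 (stdGaussian E)) (a : E) :
    ∫ u, ‖F u • u - a‖ ^ 2 ∂(stdGaussian E) ≤ 2 * ((Module.finrank ℝ E + 1) * ‖a‖ ^ 2) +
      2 * ∫ u, (F u - ⟪a, u⟫) ^ 2 * ‖u‖ ^ 2 ∂(stdGaussian E) := by
  have hmain : Integrable (fun u => ‖⟪a, u⟫ • u - a‖ ^ 2) (stdGaussian E) :=
    ((memLp_two_inner_smul_self_stdGaussian a).sub (memLp_const a)).integrable_norm_pow two_ne_zero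
  have herror : Integrable (fun u => (F u - ⟪a, u⟫) ^ 2 * ‖u‖ ^ 2) (stdGaussian E) := by
    simpa [norm_smul, mul_pow] using (memLp_two_smul_self_stdGaussian
      (hF.sub (memLp_inner_stdGaussian a (by simp)))).integrable_norm_pow two_ne_zero
  rw [← integral_norm_inner_smul_self_sub_sq_stdGaussian, ← mul_add, ← integral_add hmain herror,
    ← integral_const_mul]
  refine integral_mono_of_nonneg (.of_forall fun u => sq_nonneg _)
    ((hmain.add herror).const_mul 2) (.of_forall fun u => ?_)
  have hsplit : F u • u - a = (⟪a, u⟫ • u - a) + (F u - ⟪a, u⟫) • u := by module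
  calc ‖F u • u - a‖ ^ 2 ≤ (‖⟪a, u⟫ • u - a‖ + ‖(F u - ⟪a, u⟫) • u‖) ^ 2 := by
        rw [hsplit]
        gcongr
        exact norm_add_le _ _
    _ ≤ 2 * (‖⟪a, u⟫ • u - a‖ ^ 2 + ‖(F u - ⟪a, u⟫) • u‖ ^ 2) := add_sq_le
    _ = _ := by rw [norm_smul, mul_pow, Real.norm_eq_abs, sq_abs]

theorem memLp_norm_pow_stdGaussian (k : ℕ) {p : ENNReal} (hp : p ≠ ⊤) :
    MemLp (fun u : E => ‖u‖ ^ k) p (stdGaussian E) := by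
  rcases eq_or_ne k 0 with rfl | hk
  · simpa using memLp_const (1 : ℝ)
  · have h := (IsGaussian.memLp_id (stdGaussian E) (p * k)
      (ENNReal.mul_ne_top hp (by simp))).norm_rpow_div k
    simpa [ENNReal.mul_div_cancel_right (Nat.cast_ne_zero.2 hk)] using h

theorem memLp_of_abs_sub_inner_le {F : E → ℝ} (hF : Measurable F) {a : E} {c e : ℝ}
    (hFa : ∀ u, |F u - ⟪a, u⟫| ≤ c * ‖u‖ ^ 3 + e) {p : ENNReal} (hp : p ≠ ⊤) :
    MemLp F p (stdGaussian E) := by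
  have ha : MemLp (fun u => ⟪a, u⟫) p (stdGaussian E) := memLp_inner_stdGaussian a hp
  have herror : MemLp (fun u => F u - ⟪a, u⟫) p (stdGaussian E) :=
    (((memLp_norm_pow_stdGaussian 3 hp).const_mul c).add (memLp_const e)).mono'
      (hF.aestronglyMeasurable.sub ha.1) (.of_forall hFa)
  simpa only [Pi.add_def, sub_add_cancel] using herror.add ha

theorem integral_sq_mul_norm_pow_le_of_abs_le {ρ : E → ℝ} {c e : ℝ}
    (hρ : ∀ u, |ρ u| ≤ c * ‖u‖ ^ 3 + e) (j : ℕ) :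
    ∫ u, ρ u ^ 2 * ‖u‖ ^ (2 * j) ∂(stdGaussian E) ≤
      2 * c ^ 2 * (((2 * (j + 3) - 1 : ℕ)‼ : ℝ) * (Module.finrank ℝ E : ℝ) ^ (j + 3)) +
        2 * e ^ 2 * (((2 * j - 1 : ℕ)‼ : ℝ) * (Module.finrank ℝ E : ℝ) ^ j) := by
  have hhigh := (integrable_norm_pow_stdGaussian (E := E) (2 * (j + 3))).const_mul (2 * c ^ 2)
  have hlow := (integrable_norm_pow_stdGaussian (E := E) (2 * j)).const_mul (2 * e ^ 2)
  have hpoint : ∀ u, ρ u ^ 2 * ‖u‖ ^ (2 * j) ≤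
      2 * c ^ 2 * ‖u‖ ^ (2 * (j + 3)) + 2 * e ^ 2 * ‖u‖ ^ (2 * j) := fun u =>
    calc ρ u ^ 2 * ‖u‖ ^ (2 * j) ≤ (c * ‖u‖ ^ 3 + e) ^ 2 * ‖u‖ ^ (2 * j) := by
          rw [← sq_abs]
          gcongr
          exact hρ u
      _ ≤ 2 * ((c * ‖u‖ ^ 3) ^ 2 + e ^ 2) * ‖u‖ ^ (2 * j) := by
          gcongr
          exact add_sq_le
      _ = _ := by ring
  calc ∫ u, ρ u ^ 2 * ‖u‖ ^ (2 * j) ∂(stdGaussian E)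
      ≤ ∫ u, (2 * c ^ 2 * ‖u‖ ^ (2 * (j + 3)) + 2 * e ^ 2 * ‖u‖ ^ (2 * j)) ∂(stdGaussian E) :=
        integral_mono_of_nonneg (.of_forall fun u => by positivity) (hhigh.add hlow)
          (.of_forall hpoint)
    _ = 2 * c ^ 2 * ∫ u, ‖u‖ ^ (2 * (j + 3)) ∂(stdGaussian E) +
          2 * e ^ 2 * ∫ u, ‖u‖ ^ (2 * j) ∂(stdGaussian E) := by
        rw [integral_add hhigh hlow, integral_const_mul, integral_const_mul]
    _ ≤ _ := by
        gcongr <;> exact integral_norm_pow_two_mul_stdGaussian_le _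

-- `72 * c` and `12 * e` below come from the range of `σ`: the slope error has `c = M * σ ^ 2 / 6`
-- and `e = εf / σ`, so `72 * c = 12 * (M * σ ^ 2)`.
theorem norm_integral_smul_self_sub_le_div_six [Nontrivial E] {F : E → ℝ} (hF : Measurable F)
    {a : E} {c e s : ℝ} (hFa : ∀ u, |F u - ⟪a, u⟫| ≤ c * ‖u‖ ^ 3 + e) (hs : 0 ≤ s)
    (hc : (72 * c) ^ 2 * (Module.finrank ℝ E : ℝ) ^ 3 ≤ s ^ 2)
    (he : (12 * e * Module.finrank ℝ E) ^ 2 ≤ s ^ 2) :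
    ‖∫ u, F u • u ∂(stdGaussian E) - a‖ ≤ s / 6 := by
  have hn : (1 : ℝ) ≤ (Module.finrank ℝ E : ℝ) := Nat.one_le_cast.2 Module.finrank_pos
  have herror : ∫ u, (F u - ⟪a, u⟫) ^ 2 ∂(stdGaussian E) ≤
      30 * c ^ 2 * (Module.finrank ℝ E : ℝ) ^ 3 + 2 * e ^ 2 := by
    have h := integral_sq_mul_norm_pow_le_of_abs_le hFa 0
    norm_num [Nat.doubleFactorial] at h
    linarith
  have hes : (12 * e) ^ 2 ≤ s ^ 2 :=
    calc (12 * e) ^ 2 ≤ (12 * e) ^ 2 * (Module.finrank ℝ E : ℝ) ^ 2 :=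
          le_mul_of_one_le_right (sq_nonneg _) (one_le_pow₀ hn)
      _ ≤ s ^ 2 := by rwa [← mul_pow]
  have hbias := norm_integral_smul_self_sub_sq_le
    (memLp_of_abs_sub_inner_le hF hFa ENNReal.ofNat_ne_top) a
  exact (sq_le_sq₀ (norm_nonneg _) (by positivity)).1 (by linarith [sq_nonneg s])

theorem integral_norm_smul_self_sub_sq_le_of_abs_le [Nontrivial E] {F : E → ℝ}
    (hF : Measurable F) {a : E} {c e s : ℝ} (hFa : ∀ u, |F u - ⟪a, u⟫| ≤ c * ‖u‖ ^ 3 + e)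
    (hsa : s ^ 2 ≤ ‖a‖ ^ 2)
    (hc : (72 * c) ^ 2 * (Module.finrank ℝ E : ℝ) ^ 3 ≤ s ^ 2)
    (he : (12 * e * Module.finrank ℝ E) ^ 2 ≤ s ^ 2) :
    ∫ u, ‖F u • u - a‖ ^ 2 ∂(stdGaussian E) ≤
      25 / 12 * (Module.finrank ℝ E + 1) * ‖a‖ ^ 2 := by
  have hn : (1 : ℝ) ≤ (Module.finrank ℝ E : ℝ) := Nat.one_le_cast.2 Module.finrank_pos
  have herror : ∫ u, (F u - ⟪a, u⟫) ^ 2 * ‖u‖ ^ 2 ∂(stdGaussian E) ≤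
      210 * c ^ 2 * (Module.finrank ℝ E : ℝ) ^ 4 + 2 * e ^ 2 * Module.finrank ℝ E := by
    have h := integral_sq_mul_norm_pow_le_of_abs_le hFa 1
    norm_num [Nat.doubleFactorial] at h
    linarith
  have hcn : 210 * c ^ 2 * (Module.finrank ℝ E : ℝ) ^ 4 ≤ s ^ 2 / 24 * Module.finrank ℝ E := by
    have h := mul_le_mul_of_nonneg_right hc (zero_le_one.trans hn)
    linarith [mul_nonneg (sq_nonneg s) (zero_le_one.trans hn)]
  have hen : 2 * e ^ 2 * Module.finrank ℝ E ≤ s ^ 2 / 24 :=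
    calc 2 * e ^ 2 * (Module.finrank ℝ E : ℝ) ≤ 2 * e ^ 2 * (Module.finrank ℝ E : ℝ) ^ 2 := by
          gcongr
          exact le_self_pow₀ hn two_ne_zero
      _ ≤ s ^ 2 / 24 := by linarith [sq_nonneg s]
  have hsn : s ^ 2 * (Module.finrank ℝ E + 1) ≤ ‖a‖ ^ 2 * (Module.finrank ℝ E + 1) := by gcongr
  have hmoment := integral_norm_smul_self_sub_sq_le
    (memLp_of_abs_sub_inner_le hF hFa ENNReal.ofNat_ne_top) a
  linarith

theorem measureReal_lt_norm_sample_mean_smul_self_sub_le {Ω ι : Type*} [MeasurableSpace Ω]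
    {P : Measure Ω} [IsProbabilityMeasure P] [Fintype ι] [Nonempty ι] {U : ι → Ω → E}
    (hU : ∀ i, HasLaw (U i) (stdGaussian E) P) (hind : iIndepFun U P) {F : E → ℝ}
    (hF : Measurable F) {a : E} (ha : a ≠ 0) {c e θ : ℝ} (hθ0 : 0 < θ) (hθ1 : θ ≤ 1)
    (hFa : ∀ u, |F u - ⟪a, u⟫| ≤ c * ‖u‖ ^ 3 + e)
    (hc : (72 * c) ^ 2 * (Module.finrank ℝ E : ℝ) ^ 3 ≤ (θ * ‖a‖) ^ 2)
    (he : (12 * e * Module.finrank ℝ E) ^ 2 ≤ (θ * ‖a‖) ^ 2) :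
    P.real {ω | θ * ‖a‖ < ‖(Fintype.card ι : ℝ)⁻¹ • ∑ i, F (U i ω) • U i ω - a‖} ≤
      3 * (Module.finrank ℝ E + 1) / (Fintype.card ι * θ ^ 2) := by
  have : Nontrivial E := ⟨a, 0, ha⟩
  have hnorm : 0 < ‖a‖ := norm_pos_iff.2 ha
  set m := ∫ u, F u • u ∂(stdGaussian E)
  have hmeas : Measurable fun u : E => F u • u := hF.smul measurable_id
  have hL2 : MemLp (fun u => F u • u) 2 (stdGaussian E) :=
    memLp_two_smul_self_stdGaussian (memLp_of_abs_sub_inner_le hF hFa ENNReal.ofNat_ne_top)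
  have hsa : (θ * ‖a‖) ^ 2 ≤ ‖a‖ ^ 2 := by
    gcongr
    exact mul_le_of_le_one_left hnorm.le hθ1
  have hvar : ∫ u, ‖F u • u - m‖ ^ 2 ∂(stdGaussian E) ≤
      25 / 12 * (Module.finrank ℝ E + 1) * ‖a‖ ^ 2 :=
    le_trans (by rw [integral_norm_sub_sq_eq_add hL2 a]; exact le_add_of_nonneg_right (sq_nonneg _))
      (integral_norm_smul_self_sub_sq_le_of_abs_le hF hFa hsa hc he)
  have hbias : ‖m - a‖ ≤ θ * ‖a‖ / 6 :=
    norm_integral_smul_self_sub_le_div_six hF hFa (by positivity) hc he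
  have hchebyshev := measureReal_le_norm_sample_mean_sub_le (P := P)
    (X := fun i ω => F (U i ω) • U i ω) (m := m) (t := 5 / 6 * (θ * ‖a‖))
    (fun i => ((hU i).map_eq.symm ▸ hL2).comp_of_map (hU i).aemeasurable)
    (fun i j hij => (hind.indepFun hij).comp hmeas hmeas)
    (fun i => (hU i).integral_comp hL2.1)
    (fun i => ((hU i).integral_comp (f := fun u => ‖F u • u - m‖ ^ 2)
      ((hL2.1.sub aestronglyMeasurable_const).norm.pow 2)).trans_le hvar)
    (by positivity)
  refine (measureReal_mono fun ω hω => ?_).trans (hchebyshev.trans_eq ?_)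
  · have htriangle := norm_sub_le_norm_sub_add_norm_sub
      ((Fintype.card ι : ℝ)⁻¹ • ∑ i, F (U i ω) • U i ω) m a
    simp only [Set.mem_ofPred_eq] at hω ⊢
    linarith
  · field_simp
    norm_num

end GaussianEstimator

section Taylor

variable {E F : Type*} [NormedAddCommGroup E] [NormedSpace ℝ E] [NormedAddCommGroup F]
  [NormedSpace ℝ F]

theorem norm_le_mul_pow_succ_of_norm_deriv_le {g g' : ℝ → F} (hg : ∀ t, HasDerivAt g (g' t) t)
    (hg0 : g 0 = 0) {C : ℝ} {k : ℕ} (hg' : ∀ t, 0 ≤ t → ‖g' t‖ ≤ C * ((k + 1) * t ^ k))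
    {t : ℝ} (ht : 0 ≤ t) : ‖g t‖ ≤ C * t ^ (k + 1) := by
  have hbound : ∀ s : ℝ, HasDerivAt (fun s => C * s ^ (k + 1)) (C * ((k + 1) * s ^ k)) s :=
    fun s => by simpa using (hasDerivAt_pow (k + 1) s).const_mul C
  exact image_norm_le_of_norm_deriv_right_le_deriv_boundary
    (fun s _ => (hg s).continuousAt.continuousWithinAt) (fun s _ => (hg s).hasDerivWithinAt)
    (by simp [hg0]) hbound (fun s hs => hg' s hs.1) (Set.right_mem_Icc.2 ht)

theorem norm_sub_sub_two_smul_deriv_zero_le {g g' g'' : ℝ → F} (hg : ∀ t, HasDerivAt g (g' t) t)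
    (hg' : ∀ t, HasDerivAt g' (g'' t) t) {L : ℝ} (hL : ∀ s t, ‖g'' s - g'' t‖ ≤ L * |s - t|) :
    ‖g 1 - g (-1) - (2 : ℝ) • g' 0‖ ≤ L / 3 := by
  have hodd : ∀ t, HasDerivAt (fun t => g t - g (-t) - (2 * t) • g' 0)
      (g' t + g' (-t) - (2 : ℝ) • g' 0) t := fun t => by
    have h := ((hg t).sub ((hg (-t)).scomp t (hasDerivAt_neg t))).sub
      (((hasDerivAt_id t).const_mul 2).smul_const (g' 0))
    convert! h using 1
    module
  have heven : ∀ t, HasDerivAt (fun t => g' t + g' (-t) - (2 : ℝ) • g' 0)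
      (g'' t - g'' (-t)) t := fun t => by
    have h := ((hg' t).add ((hg' (-t)).scomp t (hasDerivAt_neg t))).sub_const ((2 : ℝ) • g' 0)
    convert! h using 1
    module
  have hsecond : ∀ t, 0 ≤ t → ‖g'' t - g'' (-t)‖ ≤ L * ((1 + 1) * t ^ 1) := fun t ht => by
    have h := hL t (-t)
    rw [sub_neg_eq_add, abs_of_nonneg (by positivity)] at h
    linarith
  have hfirst : ∀ t, 0 ≤ t → ‖g' t + g' (-t) - (2 : ℝ) • g' 0‖ ≤ L / 3 * ((2 + 1) * t ^ 2) :=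
    fun t ht => (norm_le_mul_pow_succ_of_norm_deriv_le heven (by simp [two_smul]) (k := 1)
      (mod_cast hsecond) ht).trans_eq (by ring)
  simpa using norm_le_mul_pow_succ_of_norm_deriv_le hodd (by simp) (k := 2) (mod_cast hfirst)
    zero_le_one

theorem abs_central_difference_sub_fderiv_le {φ : E → ℝ} {M : ℝ} (hφ : ContDiff ℝ 2 φ)
    (hM : ∀ x y, ‖fderiv ℝ (fderiv ℝ φ) x - fderiv ℝ (fderiv ℝ φ) y‖ ≤ M * ‖x - y‖) (x w : E) :
    |φ (x + w) - φ (x - w) - 2 * fderiv ℝ φ x w| ≤ M * ‖w‖ ^ 3 / 3 := by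
  have hφ' : Differentiable ℝ φ := hφ.differentiable two_ne_zero
  have hφ'' : Differentiable ℝ (fderiv ℝ φ) :=
    (hφ.fderiv_right (m := 1) le_rfl).differentiable one_ne_zero
  have hline : ∀ t : ℝ, HasDerivAt (fun t : ℝ => x + t • w) w t := fun t => by
    simpa using ((hasDerivAt_id t).smul_const w).const_add x
  have hg : ∀ t : ℝ, HasDerivAt (fun t : ℝ => φ (x + t • w)) (fderiv ℝ φ (x + t • w) w) t :=
    fun t => (hφ' _).hasFDerivAt.comp_hasDerivAt t (hline t)
  have hg' : ∀ t : ℝ, HasDerivAt (fun t : ℝ => fderiv ℝ φ (x + t • w) w)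
      (fderiv ℝ (fderiv ℝ φ) (x + t • w) w w) t := fun t => by
    simpa using ((hφ'' _).hasFDerivAt.comp_hasDerivAt t (hline t)).clm_apply (hasDerivAt_const t w)
  have hLipschitz : ∀ s t : ℝ, ‖fderiv ℝ (fderiv ℝ φ) (x + s • w) w w -
      fderiv ℝ (fderiv ℝ φ) (x + t • w) w w‖ ≤ M * ‖w‖ ^ 3 * |s - t| := fun s t => by
    rw [← sub_apply, ← sub_apply]
    calc _ ≤ ‖fderiv ℝ (fderiv ℝ φ) (x + s • w) - fderiv ℝ (fderiv ℝ φ) (x + t • w)‖ * ‖w‖ * ‖w‖ :=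
          ContinuousLinearMap.le_opNorm₂ _ _ _
      _ ≤ M * ‖(x + s • w) - (x + t • w)‖ * ‖w‖ * ‖w‖ := by gcongr; exact hM _ _
      _ = _ := by
          rw [add_sub_add_left_eq_sub, ← sub_smul, norm_smul, Real.norm_eq_abs]
          ring
  simpa [sub_eq_add_neg] using norm_sub_sub_two_smul_deriv_zero_le hg hg' hLipschitz

end Taylor

section CentralDifferences

variable {n N : ℕ} {f φ : EuclideanSpace ℝ (Fin n) → ℝ} {M εf σ : ℝ}

/-- The central difference quotient of `f` at `x` in direction `u` with radius `σ`, an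
approximation of the directional derivative `⟪∇f(x), u⟫`. -/
noncomputable def centralSlope (f : EuclideanSpace ℝ (Fin n) → ℝ) (σ : ℝ)
    (x u : EuclideanSpace ℝ (Fin n)) : ℝ :=
  (f (x + σ • u) - f (x - σ • u)) / (2 * σ)

theorem measurable_centralSlope (hf : Measurable f) (σ : ℝ) (x : EuclideanSpace ℝ (Fin n)) :
    Measurable (centralSlope f σ x) := by
  unfold centralSlope
  fun_prop

theorem centralGSG_eq_inv_smul_sum_centralSlope (f : EuclideanSpace ℝ (Fin n) → ℝ) (σ : ℝ)
    (u : Fin N → EuclideanSpace ℝ (Fin n)) (x : EuclideanSpace ℝ (Fin n)) :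
    centralGSG f σ u x = (N : ℝ)⁻¹ • ∑ i, centralSlope f σ x (u i) • u i := by
  simp_rw [centralGSG, centralSlope, Finset.smul_sum, smul_smul]
  congr! 2
  simp only [mul_inv, div_eq_mul_inv]
  ring

theorem abs_centralSlope_sub_inner_gradient_le (hσ : 0 < σ) (hnoise : BoundedNoise f φ εf)
    (hφ : HasLipschitzHessian φ M) (x u : EuclideanSpace ℝ (Fin n)) :
    |centralSlope f σ x u - ⟪gradient φ x, u⟫| ≤ M * σ ^ 2 / 6 * ‖u‖ ^ 3 + εf / σ := by
  have hTaylor : |φ (x + σ • u) - φ (x - σ • u) - 2 * (σ * ⟪gradient φ x, u⟫)| ≤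
      M * (σ * ‖u‖) ^ 3 / 3 := by
    have h := abs_central_difference_sub_fderiv_le hφ.1 hφ.2 x (σ • u)
    rwa [map_smul, smul_eq_mul, ← inner_gradient_left, norm_smul, Real.norm_of_nonneg hσ.le] at h
  have hquotient : centralSlope f σ x u - ⟪gradient φ x, u⟫ =
      (f (x + σ • u) - f (x - σ • u) - 2 * (σ * ⟪gradient φ x, u⟫)) / (2 * σ) := by
    unfold centralSlope
    field_simp
  have hbound : (M * σ ^ 2 / 6 * ‖u‖ ^ 3 + εf / σ) * (2 * σ) =
      M * (σ * ‖u‖) ^ 3 / 3 + 2 * εf := by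
    field_simp
    ring
  rw [hquotient, abs_div, abs_of_pos (mul_pos two_pos hσ), div_le_iff₀ (mul_pos two_pos hσ),
    hbound, abs_le]
  have hplus := abs_le.1 (hnoise.2 (x + σ • u))
  have hminus := abs_le.1 (hnoise.2 (x - σ • u))
  have hsmooth := abs_le.1 hTaylor
  constructor <;> linarith

end CentralDifferences

section ParameterBounds

variable {n N M εf s σ θ δ : ℝ}

theorem sq_mul_pow_three_le_sq_of_le_sqrt (hn : 0 < n) (hM : 0 < M) (hσ : 0 < σ)
    (h : σ ≤ √(s / (12 * n ^ (3 / 2 : ℝ) * M))) : (12 * (M * σ ^ 2)) ^ 2 * n ^ 3 ≤ s ^ 2 := by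
  have hpow : n ^ 3 = (n ^ (3 / 2 : ℝ)) ^ 2 := by
    rw [← Real.rpow_mul_natCast hn.le]
    norm_num
  have hlinear := (Real.le_sqrt' hσ).1 h
  rw [le_div_iff₀ (by positivity)] at hlinear
  rw [hpow, ← mul_pow]
  gcongr
  linarith

theorem sq_div_mul_le_of_rpow_le (hn : 0 < n) (hM : 0 < M) (hε : 0 ≤ εf) (hσ : 0 < σ)
    (h : (εf / (√n * M)) ^ (1 / 3 : ℝ) ≤ σ) : (εf / σ * n) ^ 2 ≤ (M * σ ^ 2) ^ 2 * n ^ 3 := by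
  have hcube : εf ≤ √n * M * σ ^ 3 := by
    rwa [one_div, Real.rpow_inv_le_iff_of_pos (by positivity) hσ.le three_pos,
      div_le_iff₀' (by positivity), Real.rpow_ofNat] at h
  calc (εf / σ * n) ^ 2 ≤ (√n * M * σ ^ 3 / σ * n) ^ 2 := by gcongr
    _ = √n ^ 2 * (M * σ ^ 2) ^ 2 * n ^ 2 := by field_simp
    _ = (M * σ ^ 2) ^ 2 * n ^ 3 := by
        rw [Real.sq_sqrt hn.le]
        ring

theorem three_mul_add_one_div_le_of_sample_size_le (hn : 1 < n) (hδ : 0 < δ)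
    (hN : 3 * n / (δ * θ ^ 2) * (n / (√n - 1) ^ 2) + (n + 6) / (144 * δ) + 1 / (6 * δ) ≤ N) :
    3 * (n + 1) / (δ * θ ^ 2) ≤ N := by
  have hsqrt : 0 < √n - 1 := sub_pos.2 (Real.lt_sqrt_of_sq_lt (by rwa [one_pow]))
  have hn' : 0 ≤ n := zero_le_one.trans hn.le
  have hdim : n + 1 ≤ n * (n / (√n - 1) ^ 2) := by
    rw [← mul_div_assoc, le_div_iff₀ (by positivity)]
    nlinarith [Real.sq_sqrt hn', mul_nonneg hn' hsqrt.le]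
  calc 3 * (n + 1) / (δ * θ ^ 2) ≤ 3 * (n * (n / (√n - 1) ^ 2)) / (δ * θ ^ 2) := by gcongr
    _ = 3 * n / (δ * θ ^ 2) * (n / (√n - 1) ^ 2) := by ring
    _ ≤ _ := le_trans (by rw [add_assoc]; exact le_add_of_nonneg_right (by positivity)) hN

end ParameterBounds

theorem corollary2p8_general {n N : ℕ} (hn : 0 < n)
    (f φ : EuclideanSpace ℝ (Fin n) → ℝ) (hf : Measurable f)
    {M εf σ θ δ : ℝ} (hM : 0 < M) (hσ : 0 < σ) (hθ0 : 0 < θ) (hθ1 : θ ≤ 1) (hδ : 0 < δ)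
    (hnoise : BoundedNoise f φ εf) (hφ : HasLipschitzHessian φ M)
    {Ω : Type*} [MeasurableSpace Ω] (P : Measure Ω) [IsProbabilityMeasure P]
    (u : Fin N → Ω → EuclideanSpace ℝ (Fin n))
    (hu : ∀ i, HasLaw (u i) (stdGaussian (EuclideanSpace ℝ (Fin n))) P)
    (hind : iIndepFun u P) (x : EuclideanSpace ℝ (Fin n))
    (hN : 3 * ((n : ℝ) + 1) / (δ * θ ^ 2) ≤ N)
    (hσ_lower : (εf / (√n * M)) ^ (1 / 3 : ℝ) ≤ σ)
    (hσ_upper : σ ≤ √(θ * ‖gradient φ x‖ / (12 * (n : ℝ) ^ (3 / 2 : ℝ) * M))) :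
    1 - δ ≤ P.real {ω | NormCondition φ θ x (centralGSG f σ (fun i => u i ω) x)} := by
  have hn' : (0 : ℝ) < n := Nat.cast_pos.2 hn
  have hNpos : (0 : ℝ) < N := lt_of_lt_of_le (by positivity) hN
  have : Nonempty (Fin N) := Fin.pos_iff_nonempty.1 (Nat.cast_pos.1 hNpos)
  have hradius := sq_mul_pow_three_le_sq_of_le_sqrt hn' hM hσ hσ_upper
  have hnoise_radius := sq_div_mul_le_of_rpow_le hn' hM hnoise.1 hσ hσ_lower
  have hgradient : gradient φ x ≠ 0 := fun h => by
    rw [h, norm_zero, mul_zero, zero_pow two_ne_zero] at hradius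
    exact hradius.not_gt (by positivity)
  have hbad := measureReal_lt_norm_sample_mean_smul_self_sub_le hu hind
    (measurable_centralSlope hf σ x) hgradient hθ0 hθ1
    (abs_centralSlope_sub_inner_gradient_le hσ hnoise hφ x)
    (by rw [finrank_euclideanSpace_fin]; linarith) (by rw [finrank_euclideanSpace_fin]; linarith)
  rw [finrank_euclideanSpace_fin, Fintype.card_fin] at hbad
  have hδ_bound : 3 * ((n : ℝ) + 1) / (N * θ ^ 2) ≤ δ := by
    rw [div_le_iff₀ (by positivity)] at hN ⊢
    linarith
  have hcompl : {ω | NormCondition φ θ x (centralGSG f σ (fun i => u i ω) x)}ᶜ =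
      {ω | θ * ‖gradient φ x‖ <
        ‖(N : ℝ)⁻¹ • ∑ i, centralSlope f σ x (u i ω) • u i ω - gradient φ x‖} := by
    ext ω
    simp [NormCondition, centralGSG_eq_inv_smul_sum_centralSlope]
  have hcover := measureReal_union_le (μ := P)
    {ω | NormCondition φ θ x (centralGSG f σ (fun i => u i ω) x)}
    {ω | NormCondition φ θ x (centralGSG f σ (fun i => u i ω) x)}ᶜ
  rw [Set.union_compl_self, probReal_univ, hcompl] at hcover
  linarith

theorem corollary2p8 {n N : ℕ} (hn : 1 < n)
    (f φ : EuclideanSpace ℝ (Fin n) → ℝ) (hf : Measurable f)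
    {M εf σ θ δ : ℝ} (hM : 0 < M) (hσ : 0 < σ)
    (hθ0 : 0 < θ) (hθ1 : θ < 1) (hδ0 : 0 < δ) (hδ1 : δ < 1)
    (hnoise : BoundedNoise f φ εf) (hφ : HasLipschitzHessian φ M)
    {Ω : Type*} [MeasurableSpace Ω] (P : Measure Ω) [IsProbabilityMeasure P]
    (u : Fin N → Ω → EuclideanSpace ℝ (Fin n))
    (hu : ∀ i, HasLaw (u i) (stdGaussian (EuclideanSpace ℝ (Fin n))) P)
    (hind : iIndepFun u P)
    (x : EuclideanSpace ℝ (Fin n))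
    (hN : 3 * (n : ℝ) / (δ * θ ^ 2) * ((n : ℝ) / (Real.sqrt n - 1) ^ 2)
        + ((n : ℝ) + 6) / (144 * δ) + 1 / (6 * δ) ≤ (N : ℝ))
    (hσ_lower : (εf / (Real.sqrt n * M)) ^ (1 / 3 : ℝ) ≤ σ)
    (hσ_upper : σ ≤ Real.sqrt (θ * ‖gradient φ x‖ / (12 * (n : ℝ) ^ (3 / 2 : ℝ) * M)))
    (hgrad : 12 * ((n : ℝ) ^ (7 / 2 : ℝ) * M * εf ^ 2) ^ (1 / 3 : ℝ) / θ ≤ ‖gradient φ x‖) :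
    1 - δ ≤ P.real {ω | NormCondition φ θ x (centralGSG f σ (fun i => u i ω) x)} := by
  exact corollary2p8_general (zero_lt_one.trans hn) f φ hf hM hσ hθ0 hθ1.le hδ0 hnoise hφ P u hu
    hind x (three_mul_add_one_div_le_of_sample_size_le (Nat.one_lt_cast.2 hn) hδ0 hN) hσ_lower
    hσ_upper
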